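/- Let $X$ be a finite graded poset with rank function $r$ (strictly increasing, and increasing by exactly one along covering relations), levels $X(0)\cup\dots\cup X(d)$, a unique minimal element (of rank $0$), and all maximal elements of rank $d$. Assume $X$ is regular: for each $i\le d$ all elements of $X(i)$ cover the same number of elements; and for all $i\le k\le d$, the number of chains $x_k>x_{k-1}>\dots>x_i$ with $x_t\in X(t)$ is the same for all endpoints $x_i<x_k$ with $x_i \in X(i)$, $x_k\in X(k)$. Let $R(k,i)$ be the number of elements of $X(i)$ below any fixed element of $X(k)$, with $R(i,i)=1$ and $R(k,i)=0$ for $k<i$, and let $R_{\max}=\max_{0\le t\le k}R(k,t)$ (for the given $k$). Let $\pi_d$ be a fully supported probability distribution on $X(d)$, and for $i<d$ let $\pi_i(x)=\frac{1}{R(i+1,i)}\sum_{y\gtrdot x}\pi_{i+1}(y)$. On $C_k=\{f:X(k)\to\mathbb R\}$ use the norm $\|f\|^2=\sum_{\tau\in X(k)}\pi_k(\tau)f(\tau)^2$. Define $U_i:C_i\to C_{i+1}$ and $D_{i+1}:C_{i+1}\to C_i$ by $$U_if(y)=\frac1{R(i+1,i)}\sum_{x\lessdot y}f(x),\qquad D_{i+1}f(x)=\frac{\sum_{y\gtrdot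 x}\pi_{i+1}(y)f(y)}{\sum_{y\gtrdot x}\pi_{i+1}(y)},$$ and let $\widecheck N_k^{k-i}=U_{k-1}\cdots U_i\,D_{i+1}\cdots D_k$ be the lower canonical walk on $C_k$ ($0\le i\le k\le d$). Let $0\le\gamma<1$ and $\delta_1,\dots,\delta_{d-1}\in[0,1]$, with the convention $\delta_0=0$. Assume that $X$ is a $(\delta,\gamma)$-eposet, i.e. $\|D_{i+1}U_i-(1-\delta_i)I-\delta_iU_{i-1}D_i\|\le\gamma$ in operator norm for all $1\le i\le d-1$, and that it is $\gamma$-non-lazy, i.e. $(U_{i-1}D_i\mathbf 1_\sigma)(\sigma)\le\gamma$ for all $1\le i\le d$ and $\sigma\in X(i)$. Put $H^0=C_0$, $H^j=\ker D_j$ for $j\ge1$, $V_k^j=U_{k-1}\cdots U_jH^j\subseteq C_k$, and $$\lambda_j(\widecheck N_k^{k-i})=\prod_{s=1}^{k-i}\Bigl(1-\prod_{t=j}^{k-s}\delta_t\Bigr),$$ where empty products equal $1$. There is an absolute constant $C>0$ such that for all such $X,d,\pi,\delta,\gamma$ and all $0\le i,j\le k\le d$ the following hold. 1. The numbers $\lambda_j(\widecheck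 N_k^{k-i})$ are approximate eigenvalues of $\widecheck N_k^{k-i}$: for all $f\in V_k^j$, $$\bigl\|\widecheck N_k^{k-i}f-\lambda_j(\widecheck N_k^{k-i})f\bigr\|\le C\,k^2R(k,j)\,\gamma\,\|f\|.$$ 2. They are controlled by regularity: if $\delta_i(1-\delta_{i-1})>0$, then $$\left|\lambda_j(\widecheck N_k^{k-i})-\frac{R(i,j)}{R(k,j)}\right|\le C\,\frac{i^4k^2R_{\max}}{\delta_i(1-\delta_{i-1})}\,\gamma .$$ For $i=0$ the right-hand side is read as $0$, and no condition on $\delta$ is needed (for $i=k=d$, where $\delta_d$ is not a parameter, any real number may be used for $\delta_d$). In particular, taking $i=k-1$, the approximate eigenvalues of the lower walk $U_{k-1}D_k$ on $X(k)$ satisfy $\lambda_j(UD)\approx R(k-1,j)/R(k,j)$ with this error. -/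

import Mathlib

universe u

namespace ExpandingPoset

/-! Throughout, `X` is a finite graded poset with a least element (`GradeMinOrder ℕ X`: the rank
function `grade ℕ` is strictly monotone, increases by exactly one along covering relations, and
vanishes at the least element). -/

section Poset

variable (X : Type u) [PartialOrder X] [GradeOrder ℕ X]

/-- The space `C_k` of real functions on the set `X(k)` of elements of rank `k`, realised as the
functions on `X` that vanish outside `X(k)`. -/
def levelSpace (k : ℕ) : Submodule ℝ (X → ℝ) where
  carrier := {f | ∀ x, grade ℕ x ≠ k → f x = 0}
  add_mem' := fun {f g} hf hg x hx => by simp [hf x hx, hg x hx]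
  zero_mem' := fun _ _ => rfl
  smul_mem' := fun c f hf x hx => by simp [hf x hx]

variable {X}

/-- The chains `a = c 0 < c 1 < ⋯ < c n = b` with one element in each rank between the ranks
of `a` and `b`. -/
def flags (a b : X) (n : ℕ) : Set (Fin (n + 1) → X) :=
  {c | StrictMono c ∧ c 0 = a ∧ c (Fin.last n) = b ∧
    ∀ t : Fin (n + 1), grade ℕ (c t) = grade ℕ a + (t : ℕ)}

variable (X)

/-- `X` is a `d`-dimensional pure graded poset that is downward regular and middle regular. -/
structure IsRegular (d : ℕ) : Prop where
  pure : ∀ x : X, IsMax x → grade ℕ x = d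
  downward : ∀ i ≤ d, ∃ R : ℕ, ∀ x : X, grade ℕ x = i → {y : X | y ⋖ x}.ncard = R
  middle : ∀ i k : ℕ, i ≤ k → k ≤ d → ∃ m : ℕ, ∀ x y : X, grade ℕ x = k → grade ℕ y = i →
    y < x → (flags y x (k - i)).ncard = m

variable [Fintype X]

open Classical in
/-- The regularity function `R(k,i)`: the number of elements of rank `i` that lie below an element
of rank `k`. The supremum over the elements of rank `k` only selects the common value: on a regular
poset this number is the same for all of them. As `≤` is used, `R(i,i) = 1`, and `R(k,i) = 0` if
`k < i`. -/
noncomputable def regFun (k i : ℕ) : ℕ :=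
  (Finset.univ.filter fun x : X => grade ℕ x = k).sup
    fun x => {y : X | grade ℕ y = i ∧ y ≤ x}.ncard

/-- `R_max`, the maximum of `R(k,t)` over `0 ≤ t ≤ k`. -/
noncomputable def regMax (k : ℕ) : ℕ := (Finset.range (k + 1)).sup fun t => regFun X k t

variable {X}

open Classical in
/-- The weights `π` (`π x` is `π_i(x)` for `x` of rank `i`) of a measured poset: `π_d` is a
distribution on `X(d)`, and `π_i` is the law of a uniformly random element covered by an element
of rank `i + 1` drawn from `π_{i+1}`. All weights are positive. -/
structure IsMeasured (d : ℕ) (π : X → ℝ) : Prop where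
  pos : ∀ x, 0 < π x
  sum_top : ∑ x with grade ℕ x = d, π x = 1
  induced : ∀ x, grade ℕ x < d →
    π x = ∑ y with x ⋖ y, (({z : X | z ⋖ y}.ncard : ℝ))⁻¹ * π y

end Poset

section Operators

variable {X : Type u} [PartialOrder X] [Fintype X]

open Classical in
/-- The up operators `U_i : C_i → C_{i+1}`, for all `i` at once: the value of `U f` at `y` is the
average of `f` over the elements covered by `y`. -/
noncomputable def up : Module.End ℝ (X → ℝ) where
  toFun f := fun y => (({z : X | z ⋖ y}.ncard : ℝ))⁻¹ * ∑ x with x ⋖ y, f x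
  map_add' f g := by
    funext y
    simp [Finset.sum_add_distrib, mul_add]
  map_smul' c f := by
    funext y
    simp only [Pi.smul_apply, smul_eq_mul, RingHom.id_apply, ← Finset.mul_sum]
    ring

open Classical in
/-- The down operators `D_{i+1} : C_{i+1} → C_i`, for all `i` at once: the value of `D f` at `x` is
the `π`-weighted average of `f` over the elements that cover `x`. -/
noncomputable def down (π : X → ℝ) : Module.End ℝ (X → ℝ) where
  toFun f := fun x => (∑ y with x ⋖ y, π y)⁻¹ * ∑ y with x ⋖ y, π y * f y
  map_add' f g := by
    funext y
    simp [Finset.sum_add_distrib, mul_add]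
  map_smul' c f := by
    funext y
    simp only [Pi.smul_apply, smul_eq_mul, RingHom.id_apply, Finset.mul_sum]
    exact Finset.sum_congr rfl fun _ _ => by ring

/-- The norm of the inner product `⟨f, g⟩ = ∑ x, π x * f x * g x`. -/
noncomputable def wnorm (π f : X → ℝ) : ℝ := Real.sqrt (∑ x, π x * f x * f x)

/-- The lower canonical walk with `n` down steps followed by `n` up steps; on `C_k` it is
`U_{k-1} ⋯ U_{k-n} D_{k-n+1} ⋯ D_k`. -/
noncomputable def lowerWalk (π : X → ℝ) (n : ℕ) : Module.End ℝ (X → ℝ) :=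
  up ^ n * down π ^ n

variable [GradeOrder ℕ X]

/-- `(X, π)` is a `(δ, γ)`-eposet of dimension `d`. The parameters are `δ 1, …, δ (d - 1)`; the value
`δ 0 = 0` is the usual convention (`D_1 U_0` is the identity), other values play no role. -/
structure IsEposet (d : ℕ) (π : X → ℝ) (δ : ℕ → ℝ) (γ : ℝ) : Prop where
  delta_zero : δ 0 = 0
  delta_mem : ∀ i, 1 ≤ i → i < d → δ i ∈ Set.Icc (0 : ℝ) 1
  gamma_nonneg : 0 ≤ γ
  gamma_lt_one : γ < 1
  expansion : ∀ i, 1 ≤ i → i < d → ∀ f ∈ levelSpace X i,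
    wnorm π (down π (up f) - (1 - δ i) • f - δ i • up (down π f)) ≤ γ * wnorm π f

open Classical in
/-- `(X, π)` is `β`-non-lazy: the lower walk `U D` stays at any element of positive rank with
probability at most `β`. -/
def IsNonLazy (π : X → ℝ) (β : ℝ) : Prop :=
  ∀ σ : X, 1 ≤ grade ℕ σ → up (down π (Pi.single σ 1)) σ ≤ β

/-- The piece `V_k^j = U_{k-1} ⋯ U_j (H^j)` of the HD-level-set decomposition of `C_k`, where `H^j`
is the kernel of `D_j` in `C_j` (for `j = 0` this is all of `C_0`). -/
noncomputable def levelSetPiece (π : X → ℝ) (k j : ℕ) : Submodule ℝ (X → ℝ) :=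
  (levelSpace X j ⊓ LinearMap.ker (down π)).map (up ^ (k - j))

end Operators

/-- The approximate eigenvalue
`λ_j(Ň_k^{k-i}) = ∏_{s=1}^{k-i} (1 - δ_j δ_{j+1} ⋯ δ_{k-s})`, an empty product
`δ_j ⋯ δ_{k-s}` (where `k - s < j`) being `1`. -/
noncomputable def approxEig (δ : ℕ → ℝ) (k i j : ℕ) : ℝ :=
  ∏ s ∈ Finset.Icc 1 (k - i), (1 - ∏ t ∈ Finset.Icc j (k - s), δ t)

end ExpandingPoset

/-!
Write `k = j + n`. By downward regularity `U` and `D` are adjoint contractions for the weighted inner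
product. Iterating the expansion inequality commutes one `D` past several `U`'s
(`IsEposet.wnorm_down_up_pow_sub_le`): on `C_j`, with `P = δ_j ⋯ δ_{j+n}`,
`D U^{n+1} ≈ (1 - P) U^n + P U^{n+1} D`. On `H^j = ker D_j` the last term vanishes, so the lower walk
multiplies `U^n h` by `λ_j`, up to an error `k² γ ‖h‖`
(`IsEposet.wnorm_lowerWalk_up_pow_sub_le`).

The link with the regularity function is the probability that the upper walk `D^n U^n` started at
`σ ∈ X(j)` returns to `σ`. On the one hand it equals `1 / R(k,j)`, because by regularity `U^n f (y)`
is the uniform average of `f` over the elements of `X(j)` below `y`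
(`IsRegular.down_pow_up_pow_single`). On the other hand, commuting all the `D`'s turns `D^n U^n` into
an approximate convex combination of the operators `U^m D^m` in which the identity has coefficient
`λ_j(Ň_k^n)`. The other terms contribute at most `‖D^m 1_σ‖² ≤ ‖D 1_σ‖²`, which non-laziness
bounds by `γ ‖1_σ‖²`. Hence `1 / R(k,j)` and `λ_j(Ň_k^{k-j})` differ by at most `2 k² γ`
(`IsEposet.abs_inv_regFun_sub_approxEig_le`).

Both claims follow. For the first, `‖U^n h‖² = ⟨h, D^n U^n h⟩ ≈ λ_j(Ň_k^n) ‖h‖² ≈ ‖h‖² / R(k,j)`, so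
`‖h‖ ≤ 2 R(k,j) ‖U^n h‖` if `k² R(k,j) γ` is small, and if it is not, the inequality is trivial. For
the second, `λ_j(Ň_k^{k-j}) = λ_j(Ň_i^{i-j}) λ_j(Ň_k^{k-i})` if `j ≤ i`, so that `λ_j(Ň_k^{k-i})`
differs from `R(i,j) / R(k,j)` by at most `4 R(i,j) k² γ`; here `R(i,j) ≤ R(k,j) ≤ R_max`, and
`i⁴ / (δ_i (1 - δ_{i-1})) ≥ 1` for `1 ≤ i < k`. In the remaining cases `i = 0`, `i = k` or `i < j`
the two numbers are equal.
-/

namespace ExpandingPoset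

/-! ### The weighted inner product -/

section Inner

variable {X : Type u} [Fintype X] {π : X → ℝ}

/-- The inner product `⟨f, g⟩ = ∑ x, π x * f x * g x` on the functions on `X`, as a linear map in
its second argument; the levels of a graded poset are orthogonal to each other. -/
noncomputable def weightedInner (π f : X → ℝ) : (X → ℝ) →ₗ[ℝ] ℝ where
  toFun g := ∑ x, π x * f x * g x
  map_add' g h := by simp [mul_add, Finset.sum_add_distrib]
  map_smul' c g := by
    simp only [Pi.smul_apply, smul_eq_mul, RingHom.id_apply, Finset.mul_sum]
    exact Finset.sum_congr rfl fun _ _ => by ring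

theorem weightedInner_apply (f g : X → ℝ) : weightedInner π f g = ∑ x, π x * f x * g x := rfl

theorem weightedInner_comm (f g : X → ℝ) : weightedInner π f g = weightedInner π g f :=
  Finset.sum_congr rfl fun _ _ => by ring

open Classical in
theorem weightedInner_single (σ : X) (g : X → ℝ) :
    weightedInner π (Pi.single σ 1) g = π σ * g σ := by
  rw [weightedInner_apply, Finset.sum_eq_single σ]
  · simp
  · intro x _ hx
    simp [hx]
  · simp

/-- The isometric embedding of the functions on `X` into Euclidean space that scales the value at
`x` by `√(π x)`. -/
noncomputable def toEuclidean (π f : X → ℝ) : EuclideanSpace ℝ X :=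
  WithLp.toLp 2 fun x => √(π x) * f x

variable (hπ : ∀ x, 0 < π x)
include hπ

theorem inner_toEuclidean (f g : X → ℝ) :
    inner ℝ (toEuclidean π f) (toEuclidean π g) = weightedInner π f g := by
  simp only [toEuclidean, PiLp.inner_apply, weightedInner_apply]
  refine Finset.sum_congr rfl fun x _ => ?_
  have h := Real.mul_self_sqrt (hπ x).le
  simp only [RCLike.inner_apply, conj_trivial]
  linear_combination (f x * g x) * h

theorem wnorm_eq_norm (f : X → ℝ) : wnorm π f = ‖toEuclidean π f‖ := by
  rw [norm_eq_sqrt_real_inner, inner_toEuclidean hπ]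
  rfl

theorem wnorm_sq (f : X → ℝ) : wnorm π f ^ 2 = weightedInner π f f := by
  rw [wnorm_eq_norm hπ, ← real_inner_self_eq_norm_sq, inner_toEuclidean hπ]

theorem abs_weightedInner_le (f g : X → ℝ) :
    |weightedInner π f g| ≤ wnorm π f * wnorm π g := by
  rw [wnorm_eq_norm hπ, wnorm_eq_norm hπ, ← inner_toEuclidean hπ]
  exact abs_real_inner_le_norm _ _

theorem wnorm_add_le (f g : X → ℝ) : wnorm π (f + g) ≤ wnorm π f + wnorm π g := by
  have h : toEuclidean π (f + g) = toEuclidean π f + toEuclidean π g := by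
    ext x
    simp [toEuclidean, mul_add]
  rw [wnorm_eq_norm hπ, wnorm_eq_norm hπ, wnorm_eq_norm hπ, h]
  exact norm_add_le _ _

theorem wnorm_smul (c : ℝ) (f : X → ℝ) : wnorm π (c • f) = |c| * wnorm π f := by
  have h : toEuclidean π (c • f) = c • toEuclidean π f := by
    ext x
    simp only [toEuclidean, Pi.smul_apply, smul_eq_mul, PiLp.smul_apply]
    ring
  rw [wnorm_eq_norm hπ, wnorm_eq_norm hπ, h, norm_smul, Real.norm_eq_abs]

end Inner

theorem wnorm_nonneg {X : Type u} [Fintype X] (π f : X → ℝ) : 0 ≤ wnorm π f := Real.sqrt_nonneg _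

@[simp]
theorem wnorm_zero {X : Type u} [Fintype X] (π : X → ℝ) : wnorm π 0 = 0 := by simp [wnorm]

/-! ### Graded posets -/

section Grade

variable {X : Type u} [PartialOrder X]

theorem grade_of_covBy [GradeOrder ℕ X] {x y : X} (h : x ⋖ y) : grade ℕ y = grade ℕ x + 1 :=
  (Order.covBy_iff_add_one_eq.1 (h.grade ℕ)).symm

theorem covBy_of_lt_of_grade [GradeOrder ℕ X] {x y : X} (h : x < y)
    (hg : grade ℕ y = grade ℕ x + 1) : x ⋖ y :=
  covBy_iff_lt_covBy_grade.2 ⟨h, Order.covBy_iff_add_one_eq.2 hg.symm⟩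

theorem eq_of_le_of_grade [GradeOrder ℕ X] {x y : X} (h : x ≤ y)
    (hg : grade ℕ x = grade ℕ y) : x = y := by
  by_contra hne
  exact (grade_strictMono (𝕆 := ℕ) (lt_of_le_of_ne h hne)).ne hg

theorem eq_bot_of_grade [OrderBot X] [GradeMinOrder ℕ X] {x : X} (h : grade ℕ x = 0) : x = ⊥ :=
  (eq_of_le_of_grade bot_le (by rw [h, grade_bot]; rfl)).symm

theorem IsRegular.exists_covBy [GradeOrder ℕ X] {d : ℕ} (hX : IsRegular X d) {x : X}
    (hx : grade ℕ x < d) : ∃ y, x ⋖ y := by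
  have : ¬ IsMax x := fun h => hx.ne (hX.pure x h)
  obtain ⟨y, hy⟩ := not_isMax_iff.1 this
  obtain ⟨z, hz, -⟩ := exists_covBy_le_of_lt hy
  exact ⟨z, hz⟩

variable [Finite X]

theorem IsRegular.grade_le [GradeOrder ℕ X] {d : ℕ} (hX : IsRegular X d) (x : X) :
    grade ℕ x ≤ d := by
  obtain ⟨y, hxy, hy⟩ := (Set.toFinite (Set.univ : Set X)).exists_le_maximal (Set.mem_univ x)
  have : IsMax y := fun z hz => hy.2 (Set.mem_univ z) hz
  exact (grade_mono hxy).trans (hX.pure y this).le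

theorem exists_covBy_of_grade_pos [OrderBot X] [GradeMinOrder ℕ X] {y : X} (hy : 0 < grade ℕ y) :
    ∃ x, x ⋖ y := by
  have : ⊥ < y := bot_lt_iff_ne_bot.2 fun h => by
    rw [h, grade_bot] at hy
    exact lt_irrefl _ hy
  obtain ⟨z, -, hz⟩ := exists_le_covBy_of_lt this
  exact ⟨z, hz⟩

theorem exists_le_of_grade [OrderBot X] [GradeMinOrder ℕ X] (y : X) {j : ℕ}
    (hj : j ≤ grade ℕ y) : ∃ x ≤ y, grade ℕ x = j := by
  obtain ⟨n, hn⟩ := Nat.exists_eq_add_of_le hj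
  induction n generalizing y with
  | zero => exact ⟨y, le_rfl, hn⟩
  | succ n ih =>
    obtain ⟨z, hz⟩ := exists_covBy_of_grade_pos (y := y) (by omega)
    have := grade_of_covBy hz
    obtain ⟨x, hx, hxj⟩ := ih z (by omega) (by omega)
    exact ⟨x, hx.trans hz.le, hxj⟩

theorem IsRegular.exists_grade_eq [OrderBot X] [GradeMinOrder ℕ X] {d : ℕ} (hX : IsRegular X d)
    {k : ℕ} (hk : k ≤ d) : ∃ y : X, grade ℕ y = k := by
  obtain ⟨y, -, hy⟩ := (Set.toFinite (Set.univ : Set X)).exists_le_maximal (Set.mem_univ ⊥)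
  have hmax : IsMax y := fun z hz => hy.2 (Set.mem_univ z) hz
  obtain ⟨x, -, hx⟩ := exists_le_of_grade y (hk.trans (hX.pure y hmax).ge)
  exact ⟨x, hx⟩

end Grade

/-! ### The up and down operators -/

section UpDown

variable {X : Type u} [PartialOrder X] [Fintype X]

open Classical in
theorem up_apply (f : X → ℝ) (y : X) :
    up f y = (({z : X | z ⋖ y}.ncard : ℝ))⁻¹ * ∑ x with x ⋖ y, f x := rfl

open Classical in
theorem down_apply (π f : X → ℝ) (x : X) :
    down π f x = (∑ y with x ⋖ y, π y)⁻¹ * ∑ y with x ⋖ y, π y * f y := rfl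

open Classical in
theorem ncard_covBy (y : X) :
    {z : X | z ⋖ y}.ncard = (Finset.univ.filter fun z : X => z ⋖ y).card := by
  rw [← Set.ncard_coe_finset]
  simp

theorem up_mem_levelSpace [GradeOrder ℕ X] {a : ℕ} {f : X → ℝ} (hf : f ∈ levelSpace X a) :
    up f ∈ levelSpace X (a + 1) := by
  classical
  intro y hy
  rw [up_apply, Finset.sum_eq_zero, mul_zero]
  intro x hx
  refine hf x fun h => hy ?_
  rw [grade_of_covBy (Finset.mem_filter.1 hx).2, h]

theorem up_pow_mem_levelSpace [GradeOrder ℕ X] {a : ℕ} {f : X → ℝ} (hf : f ∈ levelSpace X a)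
    (n : ℕ) : (up ^ n) f ∈ levelSpace X (a + n) := by
  induction n with
  | zero => simpa using hf
  | succ n ih =>
    rw [pow_succ', Module.End.mul_apply]
    exact up_mem_levelSpace ih

theorem down_mem_levelSpace [GradeOrder ℕ X] (π : X → ℝ) {a : ℕ} {f : X → ℝ}
    (hf : f ∈ levelSpace X (a + 1)) : down π f ∈ levelSpace X a := by
  classical
  intro x hx
  rw [down_apply, Finset.sum_eq_zero (f := fun y => π y * f y), mul_zero]
  intro y hy
  rw [hf y, mul_zero]
  have := grade_of_covBy (Finset.mem_filter.1 hy).2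
  omega

theorem down_eq_zero_of_mem_levelSpace_zero [GradeOrder ℕ X] (π : X → ℝ) {f : X → ℝ}
    (hf : f ∈ levelSpace X 0) : down π f = 0 := by
  classical
  funext x
  rw [down_apply, Finset.sum_eq_zero (f := fun y => π y * f y), mul_zero]
  · rfl
  intro y hy
  rw [hf y, mul_zero]
  have := grade_of_covBy (Finset.mem_filter.1 hy).2
  omega

theorem down_pow_mem_levelSpace [GradeOrder ℕ X] (π : X → ℝ) {a : ℕ} {f : X → ℝ} (n : ℕ)
    (hf : f ∈ levelSpace X (a + n)) : (down π ^ n) f ∈ levelSpace X a := by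
  induction n generalizing a with
  | zero => simpa using hf
  | succ n ih =>
    rw [pow_succ', Module.End.mul_apply]
    exact down_mem_levelSpace π (ih (a := a + 1) (by rwa [add_assoc, add_comm 1 n]))

theorem down_sq_le {π : X → ℝ} (hπ : ∀ x, 0 < π x) (f : X → ℝ) (x : X) :
    down π f x ^ 2 ≤ down π (f ^ 2) x := by
  classical
  rw [down_apply, down_apply]
  have hCS := Finset.sum_sq_le_sum_mul_sum_of_sq_le_mul
    (Finset.univ.filter fun y => x ⋖ y) (r := fun y => π y * f y) (f := π)
    (g := fun y => π y * (f ^ 2) y) (fun y _ => (hπ y).le)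
    (fun y _ => mul_nonneg (hπ y).le (sq_nonneg _)) (fun y _ => by
      simp only [Pi.pow_apply]
      exact le_of_eq (by ring))
  set S := ∑ y with x ⋖ y, π y
  rcases eq_or_ne S 0 with hS | hS
  · simp [hS]
  · calc (S⁻¹ * ∑ y with x ⋖ y, π y * f y) ^ 2
        = S⁻¹ ^ 2 * (∑ y with x ⋖ y, π y * f y) ^ 2 := mul_pow _ _ _
      _ ≤ S⁻¹ ^ 2 * (S * ∑ y with x ⋖ y, π y * (f ^ 2) y) :=
          mul_le_mul_of_nonneg_left hCS (sq_nonneg _)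
      _ = S⁻¹ * ∑ y with x ⋖ y, π y * (f ^ 2) y := by field_simp

variable [GradeOrder ℕ X] {d : ℕ} {π : X → ℝ}

open Classical in
/-- By downward regularity, the law `π_i` on `X(i)` turns the conditional average `D f` into a sum
over the covers `y` with weights `π y / #{z | z ⋖ y}`, the weights that occur in `U`. -/
theorem weight_mul_down (hX : IsRegular X d) (hπ : IsMeasured d π) (f : X → ℝ) (x : X) :
    π x * down π f x = ∑ y with x ⋖ y, (({z : X | z ⋖ y}.ncard : ℝ))⁻¹ * (π y * f y) := by
  rcases (hX.grade_le x).lt_or_eq with hx | hx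
  · obtain ⟨R, hR⟩ := hX.downward (grade ℕ x + 1) hx
    have hdeg : ∀ y ∈ Finset.univ.filter (fun y => x ⋖ y), {z : X | z ⋖ y}.ncard = R :=
      fun y hy => hR y (grade_of_covBy (Finset.mem_filter.1 hy).2)
    have hx' : π x = (R : ℝ)⁻¹ * ∑ y with x ⋖ y, π y := by
      rw [hπ.induced x hx, Finset.mul_sum]
      exact Finset.sum_congr rfl fun y hy => by rw [hdeg y hy]
    have hS : (∑ y with x ⋖ y, π y) ≠ 0 := fun h => by
      rw [h, mul_zero] at hx'
      exact (hπ.pos x).ne' hx'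
    rw [Finset.sum_congr rfl fun y hy => by rw [hdeg y hy], ← Finset.mul_sum, down_apply, hx']
    field_simp
  · have hemp : Finset.univ.filter (fun y => x ⋖ y) = ∅ := by
      refine Finset.filter_false_of_mem fun y _ hy => ?_
      have := grade_of_covBy hy
      have := hX.grade_le y
      omega
    rw [down_apply, hemp]
    simp

theorem weightedInner_up_left (hX : IsRegular X d) (hπ : IsMeasured d π) (f g : X → ℝ) :
    weightedInner π (up f) g = weightedInner π f (down π g) := by
  classical
  have h1 : weightedInner π f (down π g) =
      ∑ x, ∑ y, if x ⋖ y then f x * ((({z : X | z ⋖ y}.ncard : ℝ))⁻¹ * (π y * g y)) else 0 := by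
    rw [weightedInner_apply]
    refine Finset.sum_congr rfl fun x _ => ?_
    rw [← Finset.sum_filter, ← Finset.mul_sum, ← weight_mul_down hX hπ]
    ring
  rw [h1, Finset.sum_comm, weightedInner_apply]
  refine Finset.sum_congr rfl fun y _ => ?_
  rw [← Finset.sum_filter, ← Finset.sum_mul, up_apply]
  ring

theorem weightedInner_up_pow_left (hX : IsRegular X d) (hπ : IsMeasured d π) (n : ℕ)
    (f g : X → ℝ) :
    weightedInner π ((up ^ n) f) g = weightedInner π f ((down π ^ n) g) := by
  induction n generalizing f with
  | zero => rfl
  | succ n ih =>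
    rw [pow_succ, Module.End.mul_apply, ih, weightedInner_up_left hX hπ, pow_succ',
      Module.End.mul_apply]

theorem wnorm_down_le (hX : IsRegular X d) (hπ : IsMeasured d π) (f : X → ℝ) :
    wnorm π (down π f) ≤ wnorm π f := by
  classical
  refine Real.sqrt_le_sqrt ?_
  calc ∑ x, π x * down π f x * down π f x
      ≤ ∑ x, π x * (1 : X → ℝ) x * down π (f ^ 2) x := by
        refine Finset.sum_le_sum fun x _ => ?_
        have := mul_le_mul_of_nonneg_left (down_sq_le hπ.pos f x) (hπ.pos x).le
        simp only [Pi.one_apply]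
        linarith
    _ = ∑ y, π y * up (1 : X → ℝ) y * (f ^ 2) y := (weightedInner_up_left hX hπ 1 (f ^ 2)).symm
    _ ≤ ∑ y, π y * f y * f y := by
        refine Finset.sum_le_sum fun y _ => ?_
        have h1 : up (1 : X → ℝ) y ≤ 1 := by
          simp only [up_apply, Pi.one_apply, Finset.sum_const, ncard_covBy, nsmul_eq_mul, mul_one]
          exact inv_mul_le_one
        have := mul_le_mul_of_nonneg_left h1 (mul_nonneg (hπ.pos y).le (sq_nonneg (f y)))
        simp only [Pi.pow_apply]
        linarith

theorem wnorm_down_pow_le (hX : IsRegular X d) (hπ : IsMeasured d π) (n : ℕ) (f : X → ℝ) :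
    wnorm π ((down π ^ n) f) ≤ wnorm π f := by
  induction n with
  | zero => rfl
  | succ n ih =>
    rw [pow_succ', Module.End.mul_apply]
    exact (wnorm_down_le hX hπ _).trans ih

theorem wnorm_up_le (hX : IsRegular X d) (hπ : IsMeasured d π) (f : X → ℝ) :
    wnorm π (up f) ≤ wnorm π f := by
  have h1 := wnorm_sq hπ.pos (up f)
  rw [weightedInner_up_left hX hπ] at h1
  have h2 := (le_abs_self _).trans (abs_weightedInner_le hπ.pos f (down π (up f)))
  have h3 := mul_le_mul_of_nonneg_left (wnorm_down_le hX hπ (up f)) (wnorm_nonneg π f)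
  have h4 := wnorm_nonneg π (up f)
  have h5 := wnorm_nonneg π f
  nlinarith

theorem wnorm_up_pow_le (hX : IsRegular X d) (hπ : IsMeasured d π) (n : ℕ) (f : X → ℝ) :
    wnorm π ((up ^ n) f) ≤ wnorm π f := by
  induction n with
  | zero => rfl
  | succ n ih =>
    rw [pow_succ', Module.End.mul_apply]
    exact (wnorm_up_le hX hπ _).trans ih

end UpDown

/-- On the bottom level `D_1 U_0` is the identity, which is the case `δ 0 = 0` of the expansion
inequality, without error. -/
theorem down_up_of_mem_levelSpace_zero {X : Type u} [PartialOrder X] [OrderBot X]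
    [GradeMinOrder ℕ X] [Fintype X] {d : ℕ} {π : X → ℝ} (hX : IsRegular X d)
    (hπ : ∀ x, 0 < π x) (hd : 0 < d) {f : X → ℝ} (hf : f ∈ levelSpace X 0) :
    down π (up f) = f := by
  classical
  funext x
  by_cases hx : grade ℕ x = 0
  · have hup : ∀ y, x ⋖ y → up f y = f x := by
      intro y hy
      have huniq : ∀ z, z ⋖ y ↔ z = x := by
        refine fun z => ⟨fun hz => ?_, fun hz => hz ▸ hy⟩
        have h1 := grade_of_covBy hy
        have h2 := grade_of_covBy hz
        rw [eq_bot_of_grade hx, eq_bot_of_grade (x := z) (by omega)]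
      have hfilter : Finset.univ.filter (fun z => z ⋖ y) = {x} := by
        ext z
        simp [huniq]
      rw [up_apply, ncard_covBy, hfilter]
      simp
    obtain ⟨y, hy⟩ := hX.exists_covBy (x := x) (hx ▸ hd)
    have hS : (∑ y with x ⋖ y, π y) ≠ 0 :=
      (Finset.sum_pos (fun y _ => hπ y) ⟨y, by simpa using hy⟩).ne'
    have hsum : ∑ y with x ⋖ y, π y * up f y = (∑ y with x ⋖ y, π y) * f x := by
      rw [Finset.sum_mul]
      exact Finset.sum_congr rfl fun y hy => by rw [hup y (Finset.mem_filter.1 hy).2]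
    rw [down_apply, hsum, inv_mul_cancel_left₀ hS]
  · rw [hf x hx, down_mem_levelSpace π (up_mem_levelSpace hf) x hx]

/-! ### The approximate eigenvalues as numbers -/

theorem approxEig_eq_prod_Ico (δ : ℕ → ℝ) (k i j : ℕ) :
    approxEig δ k i j = ∏ m ∈ Finset.Ico i k, (1 - ∏ t ∈ Finset.Icc j m, δ t) := by
  refine Finset.prod_nbij' (fun s => k - s) (fun m => k - m) ?_ ?_ ?_ ?_ fun _ _ => rfl <;>
    intro s hs <;> simp only [Finset.mem_Icc, Finset.mem_Ico] at hs ⊢ <;> omega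

theorem approxEig_self (δ : ℕ → ℝ) (k j : ℕ) : approxEig δ k k j = 1 := by
  simp [approxEig_eq_prod_Ico]

theorem approxEig_succ (δ : ℕ → ℝ) {k i : ℕ} (j : ℕ) (h : i ≤ k) :
    approxEig δ (k + 1) i j = approxEig δ k i j * (1 - ∏ t ∈ Finset.Icc j k, δ t) := by
  rw [approxEig_eq_prod_Ico, approxEig_eq_prod_Ico, Finset.prod_Ico_succ_top h]

theorem approxEig_mul (δ : ℕ → ℝ) {k i j : ℕ} (hji : j ≤ i) (hik : i ≤ k) :
    approxEig δ i j j * approxEig δ k i j = approxEig δ k j j := by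
  simp only [approxEig_eq_prod_Ico]
  exact Finset.prod_Ico_consecutive _ hji hik

theorem approxEig_eq_zero (δ : ℕ → ℝ) {k i j : ℕ} (hij : i < j) (hjk : j ≤ k) :
    approxEig δ k i j = 0 := by
  rw [approxEig_eq_prod_Ico]
  exact Finset.prod_eq_zero (Finset.mem_Ico.2 ⟨le_rfl, hij.trans_le hjk⟩)
    (by rw [Finset.Icc_eq_empty (by omega)]; simp)

section Eposet

variable {X : Type u} [PartialOrder X] [Fintype X]

section GradeOrder

variable [GradeOrder ℕ X] {d : ℕ} {π : X → ℝ} {δ : ℕ → ℝ} {γ : ℝ}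

theorem IsEposet.delta_mem_Icc (hE : IsEposet d π δ γ) {t : ℕ} (ht : t < d) :
    δ t ∈ Set.Icc (0 : ℝ) 1 := by
  rcases Nat.eq_zero_or_pos t with rfl | h
  · simp [hE.delta_zero]
  · exact hE.delta_mem t h ht

theorem IsEposet.prod_delta_mem_Icc (hE : IsEposet d π δ γ) (a : ℕ) {b : ℕ} (hb : b < d) :
    ∏ t ∈ Finset.Icc a b, δ t ∈ Set.Icc (0 : ℝ) 1 :=
  have h : ∀ t ∈ Finset.Icc a b, δ t ∈ Set.Icc (0 : ℝ) 1 := fun _ ht =>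
    hE.delta_mem_Icc ((Finset.mem_Icc.1 ht).2.trans_lt hb)
  ⟨Finset.prod_nonneg fun t ht => (h t ht).1,
    Finset.prod_le_one (fun t ht => (h t ht).1) fun t ht => (h t ht).2⟩

theorem IsEposet.approxEig_mem_Icc (hE : IsEposet d π δ γ) {k : ℕ} (hk : k ≤ d) (i j : ℕ) :
    approxEig δ k i j ∈ Set.Icc (0 : ℝ) 1 := by
  rw [approxEig_eq_prod_Ico]
  have h : ∀ m ∈ Finset.Ico i k, ∏ t ∈ Finset.Icc j m, δ t ∈ Set.Icc (0 : ℝ) 1 := fun _ hm =>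
    hE.prod_delta_mem_Icc j ((Finset.mem_Ico.1 hm).2.trans_le hk)
  exact ⟨Finset.prod_nonneg fun m hm => sub_nonneg.2 (h m hm).2,
    Finset.prod_le_one (fun m hm => sub_nonneg.2 (h m hm).2) fun m hm => by
      linarith [(h m hm).1]⟩

end GradeOrder

variable [OrderBot X] [GradeMinOrder ℕ X] {d : ℕ} {π : X → ℝ} {δ : ℕ → ℝ} {γ : ℝ}

/-! ### Commuting one down step past several up steps -/

/-- Iterating the expansion inequality moves `D` past `U^{n+1}`: each step contributes an error
`γ`, since `U` is a contraction and the `δ t` are at most `1`. On the bottom level `a = 0` the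
product vanishes because of `δ 0 = 0`, and `D U` is the identity. -/
theorem IsEposet.wnorm_down_up_pow_sub_le (hE : IsEposet d π δ γ) (hX : IsRegular X d)
    (hπ : IsMeasured d π) {a n : ℕ} (hd : a + n < d) {f : X → ℝ} (hf : f ∈ levelSpace X a) :
    wnorm π (down π ((up ^ (n + 1)) f) - (1 - ∏ t ∈ Finset.Icc a (a + n), δ t) • (up ^ n) f -
      (∏ t ∈ Finset.Icc a (a + n), δ t) • (up ^ (n + 1)) (down π f)) ≤
        (n + 1) * γ * wnorm π f := by
  induction n with
  | zero =>
    rcases Nat.eq_zero_or_pos a with rfl | ha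
    · have h1 := down_up_of_mem_levelSpace_zero hX hπ.pos hd hf
      have h2 : wnorm π (0 : X → ℝ) ≤ γ * wnorm π f := by
        rw [wnorm_zero]
        exact mul_nonneg hE.gamma_nonneg (wnorm_nonneg π f)
      simpa [h1, hE.delta_zero] using h2
    · simpa using hE.expansion a ha hd f hf
  | succ n ih =>
    have ih := ih (by omega)
    have h1 := hE.expansion (a + (n + 1)) (by omega) hd _ (up_pow_mem_levelSpace hf (n + 1))
    rw [← add_assoc a n 1] at hd h1
    have hδ := hE.delta_mem_Icc hd
    rw [← add_assoc a n 1, Finset.prod_Icc_succ_top (show a ≤ a + n + 1 by omega)]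
    set P := ∏ t ∈ Finset.Icc a (a + n), δ t
    set e := δ (a + n + 1)
    set w := down π ((up ^ (n + 1)) f) - (1 - P) • (up ^ n) f - P • (up ^ (n + 1)) (down π f)
      with hw
    have hup : up w = up (down π ((up ^ (n + 1)) f)) - (1 - P) • (up ^ (n + 1)) f -
        P • (up ^ (n + 2)) (down π f) := by
      rw [hw, map_sub, map_sub, map_smul, map_smul, ← Module.End.mul_apply, ← Module.End.mul_apply,
        ← Module.End.mul_apply, ← Module.End.mul_apply, ← pow_succ', ← pow_succ']
    have hsplit : down π ((up ^ (n + 1 + 1)) f) - (1 - P * e) • (up ^ (n + 1)) f -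
        (P * e) • (up ^ (n + 1 + 1)) (down π f) =
        (down π (up ((up ^ (n + 1)) f)) - (1 - e) • (up ^ (n + 1)) f -
          e • up (down π ((up ^ (n + 1)) f))) + e • up w := by
      have : (up ^ (n + 1 + 1)) f = up ((up ^ (n + 1)) f) := by
        rw [pow_succ' up (n + 1), Module.End.mul_apply]
      rw [hup, this]
      module
    have h2 : wnorm π (e • up w) ≤ (n + 1) * γ * wnorm π f := by
      rw [wnorm_smul hπ.pos, abs_of_nonneg hδ.1]
      have := (wnorm_up_le hX hπ w).trans ih
      exact (mul_le_of_le_one_left (wnorm_nonneg _ _) hδ.2).trans this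
    have h3 := mul_le_mul_of_nonneg_left (wnorm_up_pow_le hX hπ (n + 1) f) hE.gamma_nonneg
    rw [hsplit]
    push_cast
    linarith [wnorm_add_le hπ.pos (down π (up ((up ^ (n + 1)) f)) - (1 - e) • (up ^ (n + 1)) f -
          e • up (down π ((up ^ (n + 1)) f))) (e • up w)]

/-- On the kernel of `D`, the second term produced by commuting `D` past the `U`'s vanishes, so
that down steps merely shorten a power of `U`, up to a scalar. -/
theorem IsEposet.wnorm_down_pow_up_pow_sub_le (hE : IsEposet d π δ γ) (hX : IsRegular X d)
    (hπ : IsMeasured d π) {j p m : ℕ} (hd : j + p + m ≤ d) {h : X → ℝ} (hh : h ∈ levelSpace X j)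
    (hker : down π h = 0) :
    wnorm π ((down π ^ m) ((up ^ (p + m)) h) -
      approxEig δ (j + p + m) (j + p) j • (up ^ p) h) ≤ m * (p + m) * γ * wnorm π h := by
  induction m with
  | zero => simp [approxEig_self]
  | succ m ih =>
    have ih := ih (by omega)
    have h1 := hE.wnorm_down_up_pow_sub_le hX hπ (n := p + m) (show j + (p + m) < d by omega) hh
    have hP := hE.prod_delta_mem_Icc j (show j + (p + m) < d by omega)
    rw [hker, map_zero, smul_zero, sub_zero] at h1
    rw [show j + p + (m + 1) = j + p + m + 1 from rfl, approxEig_succ δ j (by omega),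
      add_assoc j p m]
    rw [add_assoc j p m] at ih
    set P := ∏ t ∈ Finset.Icc j (j + (p + m)), δ t
    set l := approxEig δ (j + (p + m)) (j + p) j
    set w := down π ((up ^ (p + m + 1)) h) - (1 - P) • (up ^ (p + m)) h with hw
    set v := (down π ^ m) ((up ^ (p + m)) h) - l • (up ^ p) h with hv
    have hsplit : (down π ^ (m + 1)) ((up ^ (p + (m + 1))) h) - (l * (1 - P)) • (up ^ p) h =
        (down π ^ m) w + (1 - P) • v := by
      rw [hv, hw, map_sub, map_smul, pow_succ (down π) m, Module.End.mul_apply]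
      change (down π ^ m) (down π ((up ^ (p + m + 1)) h)) - _ = _
      module
    rw [hsplit]
    have h2 := (wnorm_down_pow_le hX hπ m w).trans h1
    have h3 : wnorm π ((1 - P) • v) ≤ m * (p + m) * γ * wnorm π h := by
      rw [wnorm_smul hπ.pos, abs_of_nonneg (sub_nonneg.2 hP.2)]
      exact (mul_le_of_le_one_left (wnorm_nonneg _ _) (by linarith [hP.1])).trans ih
    have h4 := wnorm_add_le hπ.pos ((down π ^ m) w) ((1 - P) • v)
    have h5 : 0 ≤ (m : ℝ) * (γ * wnorm π h) :=
      mul_nonneg m.cast_nonneg (mul_nonneg hE.gamma_nonneg (wnorm_nonneg _ _))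
    push_cast at h2 ⊢
    linarith

/-! ### The return probability of the upper walk -/

/-- Commuting the down steps past the up steps turns `D^n U^{n+l} D^l` into an approximate convex
combination of the operators `U^m D^m` with `m ≥ l`, whose quadratic forms are `‖D^m g‖²`. -/
theorem IsEposet.abs_weightedInner_down_up_down_le (hE : IsEposet d π δ γ) (hX : IsRegular X d)
    (hπ : IsMeasured d π) {j n : ℕ} (hd : j + n ≤ d) {g : X → ℝ} (hg : g ∈ levelSpace X j)
    (l : ℕ) :
    |weightedInner π g ((down π ^ n) ((up ^ (n + l)) ((down π ^ l) g)))| ≤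
      wnorm π ((down π ^ l) g) ^ 2 + n * (j + n) * γ * wnorm π g ^ 2 := by
  induction n generalizing l with
  | zero =>
    rw [pow_zero, Module.End.one_apply, zero_add, weightedInner_comm,
      weightedInner_up_pow_left hX hπ, ← wnorm_sq hπ.pos, abs_of_nonneg (sq_nonneg _)]
    simp
  | succ n ih =>
    have hG : 0 ≤ γ * wnorm π g ^ 2 := mul_nonneg hE.gamma_nonneg (sq_nonneg _)
    rcases lt_or_ge j l with hl | hl
    · have h0 : (down π ^ l) g = 0 := by
        obtain ⟨b, rfl⟩ := Nat.exists_eq_add_of_lt hl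
        have h1 := down_pow_mem_levelSpace π (a := 0) j (by rwa [zero_add])
        rw [show j + b + 1 = b + (1 + j) by omega, pow_add, pow_add, Module.End.mul_apply,
          Module.End.mul_apply, pow_one, down_eq_zero_of_mem_levelSpace_zero π h1, map_zero]
      have : 0 ≤ ((n + 1 : ℕ) : ℝ) * (j + (n + 1 : ℕ)) * (γ * wnorm π g ^ 2) := by positivity
      simp only [h0, map_zero, abs_zero, wnorm_zero]
      linarith
    · obtain ⟨a, rfl⟩ := Nat.exists_eq_add_of_le' hl
      have hv := down_pow_mem_levelSpace π l hg
      have h1 := hE.wnorm_down_up_pow_sub_le hX hπ (n := n + l)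
        (show a + (n + l) < d by omega) hv
      have hP := hE.prod_delta_mem_Icc a (show a + (n + l) < d by omega)
      have ih0 := ih (by omega) l
      have ih1 := ih (by omega) (l + 1)
      rw [pow_succ' (down π) l, Module.End.mul_apply] at ih1
      have hvg := wnorm_down_pow_le hX hπ l g
      set v := (down π ^ l) g
      set P := ∏ t ∈ Finset.Icc a (a + (n + l)), δ t
      set w := down π ((up ^ (n + l + 1)) v) - (1 - P) • (up ^ (n + l)) v -
        P • (up ^ (n + l + 1)) (down π v) with hw
      have hsplit : (down π ^ (n + 1)) ((up ^ (n + 1 + l)) v) =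
          (down π ^ n) w + (1 - P) • (down π ^ n) ((up ^ (n + l)) v) +
            P • (down π ^ n) ((up ^ (n + (l + 1))) (down π v)) := by
        rw [hw, map_sub, map_sub, map_smul, map_smul, pow_succ (down π) n, Module.End.mul_apply,
          show n + 1 + l = n + l + 1 by omega, ← add_assoc n l 1]
        module
      rw [hsplit, map_add, map_add, map_smul, map_smul, smul_eq_mul, smul_eq_mul]
      set x := weightedInner π g ((down π ^ n) ((up ^ (n + l)) v))
      set y := weightedInner π g ((down π ^ n) ((up ^ (n + (l + 1))) (down π v)))
      have hx : |(1 - P) * x| ≤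
          (1 - P) * (wnorm π v ^ 2 + n * ((a + l : ℕ) + n) * γ * wnorm π g ^ 2) := by
        rw [abs_mul, abs_of_nonneg (sub_nonneg.2 hP.2)]
        exact mul_le_mul_of_nonneg_left ih0 (sub_nonneg.2 hP.2)
      have hdv : wnorm π (down π v) ^ 2 ≤ wnorm π v ^ 2 :=
        pow_le_pow_left₀ (wnorm_nonneg _ _) (wnorm_down_le hX hπ v) 2
      have hy : |P * y| ≤
          P * (wnorm π v ^ 2 + n * ((a + l : ℕ) + n) * γ * wnorm π g ^ 2) := by
        rw [abs_mul, abs_of_nonneg hP.1]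
        exact mul_le_mul_of_nonneg_left (ih1.trans (by linarith)) hP.1
      have hz : |weightedInner π g ((down π ^ n) w)| ≤
          ((n : ℝ) + l + 1) * (γ * wnorm π g ^ 2) := by
        have hc : 0 ≤ ((n : ℝ) + l + 1) * γ := mul_nonneg (by positivity) hE.gamma_nonneg
        push_cast at h1
        calc _ ≤ wnorm π g * wnorm π ((down π ^ n) w) := abs_weightedInner_le hπ.pos _ _
          _ ≤ wnorm π g * (((n : ℝ) + l + 1) * γ * wnorm π g) :=
              mul_le_mul_of_nonneg_left ((wnorm_down_pow_le hX hπ n w).trans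
                (h1.trans (mul_le_mul_of_nonneg_left hvg hc))) (wnorm_nonneg _ _)
          _ = _ := by ring
      have h6 := abs_add_three (weightedInner π g ((down π ^ n) w)) ((1 - P) * x) (P * y)
      have h7 : 0 ≤ ((n : ℝ) + a) * (γ * wnorm π g ^ 2) := mul_nonneg (by positivity) hG
      push_cast at hx hy ⊢
      linarith

/-- If `‖D g‖² ≤ γ ‖g‖²`, then in the convex combination of the operators `U^m D^m` that
approximates `D^n U^n` only the identity is visible in the quadratic form at `g`; its coefficient
is the approximate eigenvalue. -/
theorem IsEposet.abs_weightedInner_down_pow_up_pow_sub_le (hE : IsEposet d π δ γ)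
    (hX : IsRegular X d) (hπ : IsMeasured d π) {j n : ℕ} (hd : j + n ≤ d) {g : X → ℝ}
    (hg : g ∈ levelSpace X j) (hlazy : wnorm π (down π g) ^ 2 ≤ γ * wnorm π g ^ 2) :
    |weightedInner π g ((down π ^ n) ((up ^ n) g)) - approxEig δ (j + n) j j * wnorm π g ^ 2| ≤
      (1 + n * (j + n)) * γ * wnorm π g ^ 2 := by
  have hG : 0 ≤ γ * wnorm π g ^ 2 := mul_nonneg hE.gamma_nonneg (sq_nonneg _)
  induction n with
  | zero => simpa [approxEig_self, ← wnorm_sq hπ.pos] using hG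
  | succ n ih =>
    have ih := ih (by omega)
    have h1 := hE.wnorm_down_up_pow_sub_le hX hπ (show j + n < d by omega) hg
    have hP := hE.prod_delta_mem_Icc j (show j + n < d by omega)
    have h2 := hE.abs_weightedInner_down_up_down_le hX hπ (show j + n ≤ d by omega) hg 1
    rw [pow_one] at h2
    rw [← add_assoc, approxEig_succ δ j (by omega)]
    set P := ∏ t ∈ Finset.Icc j (j + n), δ t
    set a := approxEig δ (j + n) j j
    set w := down π ((up ^ (n + 1)) g) - (1 - P) • (up ^ n) g -
      P • (up ^ (n + 1)) (down π g) with hw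
    have hsplit : (down π ^ (n + 1)) ((up ^ (n + 1)) g) =
        (down π ^ n) w + (1 - P) • (down π ^ n) ((up ^ n) g) +
          P • (down π ^ n) ((up ^ (n + 1)) (down π g)) := by
      rw [hw, map_sub, map_sub, map_smul, map_smul, pow_succ (down π) n, Module.End.mul_apply]
      module
    rw [hsplit, map_add, map_add, map_smul, map_smul, smul_eq_mul, smul_eq_mul]
    set x := weightedInner π g ((down π ^ n) ((up ^ n) g))
    set y := weightedInner π g ((down π ^ n) ((up ^ (n + 1)) (down π g)))
    set z := weightedInner π g ((down π ^ n) w)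
    have hx : |(1 - P) * (x - a * wnorm π g ^ 2)| ≤
        (1 - P) * ((1 + n * (j + n)) * γ * wnorm π g ^ 2) := by
      rw [abs_mul, abs_of_nonneg (sub_nonneg.2 hP.2)]
      exact mul_le_mul_of_nonneg_left ih (sub_nonneg.2 hP.2)
    have hy : |P * y| ≤ P * ((1 + n * (j + n)) * γ * wnorm π g ^ 2) := by
      rw [abs_mul, abs_of_nonneg hP.1]
      exact mul_le_mul_of_nonneg_left (h2.trans (by linarith)) hP.1
    have hz : |z| ≤ ((n : ℝ) + 1) * (γ * wnorm π g ^ 2) := by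
      calc _ ≤ wnorm π g * wnorm π ((down π ^ n) w) := abs_weightedInner_le hπ.pos _ _
        _ ≤ wnorm π g * (((n : ℝ) + 1) * γ * wnorm π g) :=
            mul_le_mul_of_nonneg_left ((wnorm_down_pow_le hX hπ n w).trans h1) (wnorm_nonneg _ _)
        _ = _ := by ring
    have h6 := abs_add_three z ((1 - P) * (x - a * wnorm π g ^ 2)) (P * y)
    rw [show z + (1 - P) * x + P * y - a * (1 - P) * wnorm π g ^ 2 =
      z + (1 - P) * (x - a * wnorm π g ^ 2) + P * y by ring]
    have h7 : 0 ≤ ((n : ℝ) + j) * (γ * wnorm π g ^ 2) := mul_nonneg (by positivity) hG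
    push_cast
    linarith

end Eposet

/-! ### Counting flags and the regularity function -/

open Classical in
theorem up_pow_single_of_not_le {X : Type u} [PartialOrder X] [Fintype X] {σ y : X} (n : ℕ)
    (h : ¬ σ ≤ y) :
    (up ^ n) (Pi.single σ (1 : ℝ)) y = 0 := by
  induction n generalizing y with
  | zero =>
    rw [pow_zero, Module.End.one_apply, Pi.single_eq_of_ne]
    rintro rfl
    exact h le_rfl
  | succ n ih =>
    rw [pow_succ', Module.End.mul_apply, up_apply, Finset.sum_eq_zero, mul_zero]
    exact fun z hz => ih fun hσ => h (hσ.trans (Finset.mem_filter.1 hz).2.le)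

section Flags

variable {X : Type u} [PartialOrder X] [GradeOrder ℕ X]

theorem mem_flags_init {x y : X} {n : ℕ} {c : Fin (n + 1 + 1) → X} (hc : c ∈ flags x y (n + 1)) :
    (Fin.init c : Fin (n + 1) → X) ∈ flags x (c (Fin.last n).castSucc) n := by
  obtain ⟨hm, h0, -, hg⟩ := hc
  exact ⟨fun a b h => hm (Fin.castSucc_lt_castSucc_iff.2 h), h0, rfl, fun t => hg t.castSucc⟩

theorem covBy_of_mem_flags {x y : X} {n : ℕ} {c : Fin (n + 1 + 1) → X}
    (hc : c ∈ flags x y (n + 1)) : c (Fin.last n).castSucc ⋖ y := by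
  obtain ⟨hm, -, hl, hg⟩ := hc
  have h1 := hg (Fin.last n).castSucc
  have h2 := hg (Fin.last (n + 1))
  refine covBy_of_lt_of_grade (hl ▸ hm (Fin.castSucc_lt_last _)) ?_
  rw [← hl, h1, h2]
  simp [add_assoc]

theorem snoc_mem_flags {x y z : X} {n : ℕ} {c : Fin (n + 1) → X} (hc : c ∈ flags x z n)
    (hz : z ⋖ y) : (Fin.snoc c y : Fin (n + 1 + 1) → X) ∈ flags x y (n + 1) := by
  obtain ⟨hm, h0, hl, hg⟩ := hc
  refine ⟨?_, ?_, by simp, ?_⟩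
  · rw [Fin.strictMono_iff_lt_succ]
    intro i
    induction i using Fin.lastCases with
    | last => simpa [hl] using hz.lt
    | cast i =>
      rw [← Fin.castSucc_succ, Fin.snoc_castSucc, Fin.snoc_castSucc]
      exact hm Fin.castSucc_lt_succ
  · rw [← Fin.castSucc_zero, Fin.snoc_castSucc, h0]
  · intro t
    induction t using Fin.lastCases with
    | last =>
      have := hg (Fin.last n)
      rw [hl] at this
      rw [Fin.snoc_last, grade_of_covBy hz, this]
      simp [add_assoc]
    | cast t =>
      rw [Fin.snoc_castSucc, hg t]
      rfl

open Classical in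
theorem ncard_flags_succ [Fintype X] (x y : X) (n : ℕ) :
    (flags x y (n + 1)).ncard = ∑ z with z ⋖ y, (flags x z n).ncard := by
  have hmaps : ∀ c ∈ (flags x y (n + 1)).toFinset,
      c (Fin.last n).castSucc ∈ Finset.univ.filter fun z => z ⋖ y := fun c hc => by
    simpa using covBy_of_mem_flags (Set.mem_toFinset.1 hc)
  rw [Set.ncard_eq_toFinset_card', Finset.card_eq_sum_card_fiberwise hmaps]
  refine Finset.sum_congr rfl fun z hz => ?_
  rw [Set.ncard_eq_toFinset_card']
  refine Finset.card_nbij' (fun c => Fin.init c) (fun c => Fin.snoc c y) ?_ ?_ ?_ ?_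
  · intro c hc
    simp only [Finset.coe_filter, Set.mem_toFinset, Set.mem_ofPred_eq] at hc
    have := mem_flags_init hc.1
    rw [hc.2] at this
    simpa using this
  · intro c hc
    have hc : c ∈ flags x z n := by simpa using hc
    simp only [Finset.coe_filter, Set.mem_toFinset, Set.mem_ofPred_eq]
    exact ⟨snoc_mem_flags hc (Finset.mem_filter.1 hz).2, by rw [Fin.snoc_castSucc, hc.2.2.1]⟩
  · intro c hc
    simp only [Finset.coe_filter, Set.mem_toFinset, Set.mem_ofPred_eq] at hc
    have := Fin.snoc_init_self c
    rwa [hc.1.2.2.1] at this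
  · intro c _
    exact Fin.init_snoc (α := fun _ => X) y c

variable [Fintype X]

open Classical in
/-- By downward regularity, `U^n` averages over the flags that descend from `y` with equal
weights. -/
theorem IsRegular.exists_up_pow_single_eq {d : ℕ} (hX : IsRegular X d) (n k : ℕ) :
    ∃ c : ℝ, ∀ σ y : X, grade ℕ y = k →
      (up ^ n) (Pi.single σ (1 : ℝ)) y = c * (flags σ y n).ncard := by
  induction n generalizing k with
  | zero =>
    refine ⟨1, fun σ y _ => ?_⟩
    rw [pow_zero, Module.End.one_apply, one_mul]
    have : Subsingleton (Fin (0 + 1)) := Fin.subsingleton_one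
    rcases eq_or_ne y σ with rfl | h
    · have : flags y y 0 = {fun _ => y} := by
        ext c
        refine ⟨fun hc => funext fun t => ?_, ?_⟩
        · rw [Subsingleton.elim t 0, hc.2.1]
        · rintro rfl
          refine ⟨fun a b hab => ?_, rfl, rfl, fun t => ?_⟩
          · exact absurd hab (by rw [Subsingleton.elim a b]; exact lt_irrefl b)
          · rw [Subsingleton.elim t 0]
            rfl
      simp [this]
    · have : flags σ y 0 = ∅ :=
        Set.eq_empty_of_forall_notMem fun c hc => h (hc.2.2.1.symm.trans hc.2.1)
      simp [this, h]
  | succ n ih =>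
    rcases lt_or_ge d k with hk | hk
    · exact ⟨0, fun σ y hy => absurd (hX.grade_le y) (by omega)⟩
    obtain ⟨c, hc⟩ := ih (k - 1)
    obtain ⟨R, hR⟩ := hX.downward k hk
    refine ⟨(R : ℝ)⁻¹ * c, fun σ y hy => ?_⟩
    rw [pow_succ', Module.End.mul_apply, up_apply, hR y hy, ncard_flags_succ, Nat.cast_sum,
      mul_assoc, Finset.mul_sum (a := c)]
    congr 1
    refine Finset.sum_congr rfl fun z hz => hc σ z ?_
    have := grade_of_covBy (Finset.mem_filter.1 hz).2
    omega

open Classical in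
/-- By middle regularity, `U^n 1_σ` is constant on the elements of rank `j + n` above `σ`, and the
constant depends on the ranks only. -/
theorem IsRegular.exists_up_pow_single_eq_const {d : ℕ} (hX : IsRegular X d) {j n : ℕ}
    (hd : j + n ≤ d) :
    ∃ c : ℝ, ∀ σ y : X, grade ℕ σ = j → grade ℕ y = j + n → σ ≤ y →
      (up ^ n) (Pi.single σ (1 : ℝ)) y = c := by
  obtain ⟨c, hc⟩ := hX.exists_up_pow_single_eq n (j + n)
  obtain ⟨m, hm⟩ := hX.middle j (j + n) (by omega) hd
  rw [Nat.add_sub_cancel_left] at hm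
  rcases Nat.eq_zero_or_pos n with rfl | hn
  · refine ⟨1, fun σ y hσ hy hle => ?_⟩
    rw [eq_of_le_of_grade hle (hσ.trans hy.symm)]
    simp
  · refine ⟨c * m, fun σ y hσ hy hle => ?_⟩
    have hlt : σ < y := lt_of_le_of_ne hle (by rintro rfl; omega)
    rw [hc σ y hy, hm y σ hy hσ hlt]

theorem regFun_eq_zero {i j : ℕ} (hij : i < j) : regFun X i j = 0 := by
  classical
  rw [regFun, ← bot_eq_zero, Finset.sup_eq_bot_iff]
  intro x hx
  rw [bot_eq_zero, Set.ncard_eq_zero]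
  refine Set.eq_empty_of_forall_notMem fun z hz => ?_
  have h1 := grade_mono (𝕆 := ℕ) hz.2
  rw [hz.1, (Finset.mem_filter.1 hx).2] at h1
  omega

theorem regFun_le_regMax {j k : ℕ} (hjk : j ≤ k) : regFun X k j ≤ regMax X k :=
  Finset.le_sup (f := fun t => regFun X k t) (Finset.mem_range.2 (Nat.lt_succ_of_le hjk))

theorem IsRegular.down_pow_eq_of_forall {d : ℕ} (hX : IsRegular X d) {π : X → ℝ} (hπ : ∀ x, 0 < π x)
    {f : X → ℝ} {c : ℝ} {n : ℕ} {x : X} (hd : grade ℕ x + n ≤ d)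
    (h : ∀ y, x ≤ y → grade ℕ y = grade ℕ x + n → f y = c) : (down π ^ n) f x = c := by
  classical
  induction n generalizing x with
  | zero => exact h x le_rfl rfl
  | succ n ih =>
    have hcov : ∀ y ∈ Finset.univ.filter (fun y => x ⋖ y),
        π y * (down π ^ n) f y = π y * c := by
      intro y hy
      have hxy := (Finset.mem_filter.1 hy).2
      have hg := grade_of_covBy hxy
      rw [ih (by omega) fun z hz hzg => h z (hxy.le.trans hz) (by omega)]
    obtain ⟨y, hy⟩ := hX.exists_covBy (x := x) (by omega)
    have hS : (∑ y with x ⋖ y, π y) ≠ 0 :=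
      (Finset.sum_pos (fun y _ => hπ y) ⟨y, by simpa using hy⟩).ne'
    rw [pow_succ', Module.End.mul_apply, down_apply, Finset.sum_congr rfl hcov, ← Finset.sum_mul,
      inv_mul_cancel_left₀ hS]

end Flags

section Regularity

variable {X : Type u} [PartialOrder X] [OrderBot X] [GradeMinOrder ℕ X] [Fintype X]

theorem up_eq_of_forall_covBy {f : X → ℝ} {y : X} {c : ℝ} (hy : 0 < grade ℕ y)
    (h : ∀ z, z ⋖ y → f z = c) : up f y = c := by
  classical
  obtain ⟨x, hx⟩ := exists_covBy_of_grade_pos hy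
  have hne : ((Finset.univ.filter fun z : X => z ⋖ y).card : ℝ) ≠ 0 :=
    Nat.cast_ne_zero.2 (Finset.card_ne_zero.2 ⟨x, by simpa using hx⟩)
  rw [up_apply, Finset.sum_congr rfl fun z hz => h z (Finset.mem_filter.1 hz).2, ncard_covBy,
    Finset.sum_const, nsmul_eq_mul, inv_mul_cancel_left₀ hne]

theorem up_pow_eq_of_forall_grade {f : X → ℝ} {j n : ℕ} {c : ℝ}
    (h : ∀ z, grade ℕ z = j → f z = c) {y : X} (hy : grade ℕ y = j + n) : (up ^ n) f y = c := by
  induction n generalizing y with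
  | zero => exact h y hy
  | succ n ih =>
    rw [pow_succ', Module.End.mul_apply]
    refine up_eq_of_forall_covBy (by omega) fun z hz => ih ?_
    have := grade_of_covBy hz
    omega

variable {d : ℕ}

open Classical in
/-- The values of the functions `U^n 1_σ` at `y`, for `σ` of rank `j`, sum to `1`, and those that
do not vanish are equal. Hence their common value is the inverse of the number of elements of rank
`j` below `y`, and in particular this number does not depend on `y`. -/
theorem IsRegular.inv_regFun (hX : IsRegular X d) {j n : ℕ} (hd : j + n ≤ d) {y : X}
    (hy : grade ℕ y = j + n) :
    regFun X (j + n) j = {z : X | grade ℕ z = j ∧ z ≤ y}.ncard ∧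
      ∀ σ : X, grade ℕ σ = j → σ ≤ y →
        (up ^ n) (Pi.single σ (1 : ℝ)) y = (regFun X (j + n) j : ℝ)⁻¹ := by
  obtain ⟨c, hc⟩ := hX.exists_up_pow_single_eq_const hd
  have hsum : ∀ x : X, grade ℕ x = j + n →
      ({z : X | grade ℕ z = j ∧ z ≤ x}.ncard : ℝ) * c = 1 := by
    intro x hx
    have h1 : (up ^ n) (∑ σ with grade ℕ σ = j, Pi.single σ (1 : ℝ)) x = 1 := by
      refine up_pow_eq_of_forall_grade (j := j) (fun z hz => ?_) hx
      rw [Finset.sum_apply, Finset.sum_eq_single z]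
      · simp
      · intro b _ hb
        simp [hb.symm]
      · simp [hz]
    rw [map_sum, Finset.sum_apply] at h1
    have h2 : ∀ σ ∈ Finset.univ.filter (fun σ : X => grade ℕ σ = j),
        (up ^ n) (Pi.single σ (1 : ℝ)) x = if σ ≤ x then c else 0 := by
      intro σ hσ
      split_ifs with h
      · exact hc σ x (Finset.mem_filter.1 hσ).2 hx h
      · exact up_pow_single_of_not_le n h
    rw [Finset.sum_congr rfl h2, ← Finset.sum_filter, Finset.filter_filter, Finset.sum_const,
      nsmul_eq_mul] at h1
    rw [← h1, ← Set.ncard_coe_finset]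
    simp
  have hreg : regFun X (j + n) j = {z : X | grade ℕ z = j ∧ z ≤ y}.ncard := by
    have hcongr : ∀ x ∈ Finset.univ.filter (fun x : X => grade ℕ x = j + n),
        {z : X | grade ℕ z = j ∧ z ≤ x}.ncard = {z : X | grade ℕ z = j ∧ z ≤ y}.ncard := by
      intro x hx
      have h1 := hsum x (Finset.mem_filter.1 hx).2
      have h2 := hsum y hy
      have hc0 : c ≠ 0 := fun h => by simp [h] at h2
      exact_mod_cast mul_right_cancel₀ hc0 (h1.trans h2.symm)
    rw [regFun, Finset.sup_congr rfl hcongr, Finset.sup_const ⟨y, by simpa using hy⟩]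
  refine ⟨hreg, fun σ hσ hle => ?_⟩
  rw [hc σ y hσ hy hle, hreg]
  exact eq_inv_of_mul_eq_one_right (hsum y hy)

theorem IsRegular.regFun_eq_ncard (hX : IsRegular X d) {j k : ℕ} (hjk : j ≤ k) (hk : k ≤ d) {y : X}
    (hy : grade ℕ y = k) : regFun X k j = {z : X | grade ℕ z = j ∧ z ≤ y}.ncard := by
  obtain ⟨n, rfl⟩ := Nat.exists_eq_add_of_le hjk
  exact (hX.inv_regFun hk hy).1

theorem IsRegular.regFun_pos (hX : IsRegular X d) {j k : ℕ} (hjk : j ≤ k) (hk : k ≤ d) :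
    0 < regFun X k j := by
  obtain ⟨y, hy⟩ := hX.exists_grade_eq hk
  obtain ⟨x, hxy, hx⟩ := exists_le_of_grade y (hjk.trans hy.ge)
  rw [hX.regFun_eq_ncard hjk hk hy, Set.ncard_pos]
  exact ⟨x, hx, hxy⟩

theorem IsRegular.regFun_mono (hX : IsRegular X d) {i j k : ℕ} (hji : j ≤ i) (hik : i ≤ k)
    (hk : k ≤ d) : regFun X i j ≤ regFun X k j := by
  obtain ⟨y, hy⟩ := hX.exists_grade_eq hk
  obtain ⟨x, hxy, hx⟩ := exists_le_of_grade y (hik.trans hy.ge)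
  rw [hX.regFun_eq_ncard (hji.trans hik) hk hy, hX.regFun_eq_ncard hji (hik.trans hk) hx]
  exact Set.ncard_le_ncard fun z hz => ⟨hz.1, hz.2.trans hxy⟩

theorem IsRegular.regFun_zero_right (hX : IsRegular X d) {k : ℕ} (hk : k ≤ d) :
    regFun X k 0 = 1 := by
  obtain ⟨y, hy⟩ := hX.exists_grade_eq hk
  rw [hX.regFun_eq_ncard k.zero_le hk hy, Set.ncard_eq_one]
  refine ⟨⊥, Set.ext fun z => ⟨fun hz => eq_bot_of_grade hz.1, ?_⟩⟩
  rintro rfl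
  exact ⟨grade_bot, bot_le⟩

open Classical in
/-- The upper walk from `σ` returns to `σ` with probability exactly `1 / R(j + n, j)`: every
element that it can reach lies above `σ`. -/
theorem IsRegular.down_pow_up_pow_single (hX : IsRegular X d) {π : X → ℝ} (hπ : ∀ x, 0 < π x)
    {j n : ℕ} (hd : j + n ≤ d) {σ : X} (hσ : grade ℕ σ = j) :
    (down π ^ n) ((up ^ n) (Pi.single σ (1 : ℝ))) σ = (regFun X (j + n) j : ℝ)⁻¹ :=
  hX.down_pow_eq_of_forall hπ (by omega) fun y hle hy =>
    (hX.inv_regFun hd (by omega)).2 σ hσ hle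

end Regularity

/-! ### Approximate eigenvalues of the lower walks -/

theorem wnorm_lowerWalk_le {X : Type u} [PartialOrder X] [GradeOrder ℕ X] [Fintype X] {d : ℕ}
    {π : X → ℝ} (hX : IsRegular X d) (hπ : IsMeasured d π)
    (n : ℕ) (f : X → ℝ) :
    wnorm π (lowerWalk π n f) ≤ wnorm π f :=
  (wnorm_up_pow_le hX hπ n _).trans (wnorm_down_pow_le hX hπ n f)

section LowerWalk

variable {X : Type u} [PartialOrder X] [OrderBot X] [GradeMinOrder ℕ X] [Fintype X]
  {d : ℕ} {π : X → ℝ} {δ : ℕ → ℝ} {γ : ℝ}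

/-- The return probability of the upper walk from `X(j)` to `X(k)` is `1 / R(k,j)` exactly, and by
non-laziness it is approximately `λ_j(Ň_k^{k-j})`. -/
theorem IsEposet.abs_inv_regFun_sub_approxEig_le (hE : IsEposet d π δ γ) (hX : IsRegular X d)
    (hπ : IsMeasured d π) (hlazy : IsNonLazy π γ) {j k : ℕ} (hjk : j ≤ k) (hkd : k ≤ d)
    (hk : 1 ≤ k) :
    |(regFun X k j : ℝ)⁻¹ - approxEig δ k j j| ≤ 2 * (k : ℝ) ^ 2 * γ := by
  classical
  obtain ⟨n, rfl⟩ := Nat.exists_eq_add_of_le hjk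
  obtain ⟨σ, hσ⟩ := hX.exists_grade_eq (hjk.trans hkd)
  have hmem : (Pi.single σ (1 : ℝ) : X → ℝ) ∈ levelSpace X j := fun x hx =>
    Pi.single_eq_of_ne (by rintro rfl; exact hx hσ) _
  have hnorm : wnorm π (Pi.single σ (1 : ℝ)) ^ 2 = π σ := by
    rw [wnorm_sq hπ.pos, weightedInner_single, Pi.single_eq_same, mul_one]
  have hdown : wnorm π (down π (Pi.single σ (1 : ℝ))) ^ 2 ≤
      γ * wnorm π (Pi.single σ (1 : ℝ)) ^ 2 := by
    rcases Nat.eq_zero_or_pos j with rfl | hj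
    · rw [down_eq_zero_of_mem_levelSpace_zero π hmem, wnorm_zero]
      simpa using mul_nonneg hE.gamma_nonneg (sq_nonneg _)
    · rw [hnorm, wnorm_sq hπ.pos, ← weightedInner_up_left hX hπ, weightedInner_comm,
        weightedInner_single, mul_comm γ]
      exact mul_le_mul_of_nonneg_left (hlazy σ (by omega)) (hπ.pos σ).le
  have h := hE.abs_weightedInner_down_pow_up_pow_sub_le hX hπ hkd hmem hdown
  rw [weightedInner_single, hX.down_pow_up_pow_single hπ.pos hkd hσ, hnorm, mul_comm _ (π σ),
    ← mul_sub, abs_mul, abs_of_pos (hπ.pos σ), mul_comm _ (π σ)] at h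
  refine (le_of_mul_le_mul_left h (hπ.pos σ)).trans
    (mul_le_mul_of_nonneg_right ?_ hE.gamma_nonneg)
  have h4 : (1 : ℝ) ≤ (j : ℝ) + n := by exact_mod_cast hk
  have h5 : (0 : ℝ) ≤ j := j.cast_nonneg
  push_cast
  nlinarith

/-- The eigenvalue inequality with the norm of `h` instead of that of `U^{k-j} h`. -/
theorem IsEposet.wnorm_lowerWalk_up_pow_sub_le (hE : IsEposet d π δ γ) (hX : IsRegular X d)
    (hπ : IsMeasured d π) {i j k : ℕ} (hik : i ≤ k) (hjk : j ≤ k) (hkd : k ≤ d) {h : X → ℝ}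
    (hh : h ∈ levelSpace X j) (hker : down π h = 0) :
    wnorm π (lowerWalk π (k - i) ((up ^ (k - j)) h) - approxEig δ k i j • (up ^ (k - j)) h) ≤
      (k : ℝ) ^ 2 * γ * wnorm π h := by
  have key : ∀ m p : ℕ, p + m ≤ k →
      (m : ℝ) * (p + m) * γ * wnorm π h ≤ (k : ℝ) ^ 2 * γ * wnorm π h := fun m p hmp => by
    refine mul_le_mul_of_nonneg_right (mul_le_mul_of_nonneg_right ?_ hE.gamma_nonneg)
      (wnorm_nonneg _ _)
    rw [sq]
    exact mul_le_mul (by exact_mod_cast (by omega : m ≤ k)) (by exact_mod_cast hmp)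
      (by positivity) (by positivity)
  rcases lt_or_ge i j with hij | hji
  · obtain ⟨q, rfl⟩ := Nat.exists_eq_add_of_lt hij
    obtain ⟨n, rfl⟩ := Nat.exists_eq_add_of_le hjk
    have h1 := hE.wnorm_down_pow_up_pow_sub_le hX hπ (p := 0) (m := n) (by omega) hh hker
    rw [approxEig_eq_zero δ hij (by omega), zero_smul, sub_zero, lowerWalk, Module.End.mul_apply,
      show i + q + 1 + n - i = q + 1 + n by omega, Nat.add_sub_cancel_left]
    refine (wnorm_up_pow_le hX hπ _ _).trans ?_
    simp only [zero_add, add_zero, pow_zero, Module.End.one_apply] at h1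
    -- the last `q + 1` down steps kill the main term, a multiple of `h`
    have h2 : (down π ^ (q + 1 + n)) ((up ^ n) h) = (down π ^ (q + 1))
        ((down π ^ n) ((up ^ n) h) - approxEig δ (i + q + 1 + n) (i + q + 1) (i + q + 1) • h) := by
      rw [map_sub, map_smul, pow_succ (down π) q, Module.End.mul_apply _ _ h, hker, map_zero,
        smul_zero, sub_zero, ← pow_succ, pow_add, Module.End.mul_apply]
    rw [h2]
    refine (wnorm_down_pow_le hX hπ _ _).trans (h1.trans ?_)
    simpa using key n 0 (by omega)
  · obtain ⟨p, rfl⟩ := Nat.exists_eq_add_of_le hji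
    obtain ⟨m, rfl⟩ := Nat.exists_eq_add_of_le hik
    have h1 := hE.wnorm_down_pow_up_pow_sub_le hX hπ hkd hh hker
    have h2 : lowerWalk π m ((up ^ (p + m)) h) -
        approxEig δ (j + p + m) (j + p) j • (up ^ (p + m)) h =
        (up ^ m) ((down π ^ m) ((up ^ (p + m)) h) -
          approxEig δ (j + p + m) (j + p) j • (up ^ p) h) := by
      rw [map_sub, map_smul, ← Module.End.mul_apply (up ^ m) (up ^ p), ← pow_add, add_comm m p]
      rfl
    rw [Nat.add_sub_cancel_left, show j + p + m - j = p + m by omega, h2]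
    exact ((wnorm_up_pow_le hX hπ _ _).trans h1).trans (key m p (by omega))

/-- On the kernel of `D_j` the operator `U^{k-j}` is bounded from below: `‖U^{k-j} h‖²` is close to
`λ_j(Ň_k^{k-j}) ‖h‖²`, hence to `‖h‖² / R(k,j)`. -/
theorem IsEposet.wnorm_sq_le_wnorm_up_pow_sq (hE : IsEposet d π δ γ) (hX : IsRegular X d)
    (hπ : IsMeasured d π) (hlazy : IsNonLazy π γ) {j k : ℕ} (hjk : j ≤ k) (hkd : k ≤ d)
    (hk : 1 ≤ k) {h : X → ℝ} (hh : h ∈ levelSpace X j) (hker : down π h = 0) :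
    ((regFun X k j : ℝ)⁻¹ - 3 * (k : ℝ) ^ 2 * γ) * wnorm π h ^ 2 ≤
      wnorm π ((up ^ (k - j)) h) ^ 2 := by
  have hR := abs_le.1 (hE.abs_inv_regFun_sub_approxEig_le hX hπ hlazy hjk hkd hk)
  obtain ⟨n, rfl⟩ := Nat.exists_eq_add_of_le hjk
  have h1 := hE.wnorm_down_pow_up_pow_sub_le hX hπ (p := 0) (m := n) (by omega) hh hker
  simp only [zero_add, add_zero, pow_zero, Module.End.one_apply, Nat.cast_zero] at h1
  rw [Nat.add_sub_cancel_left, wnorm_sq hπ.pos ((up ^ n) h), weightedInner_up_pow_left hX hπ]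
  set l := approxEig δ (j + n) j j
  set w := (down π ^ n) ((up ^ n) h) - l • h with hw
  have h2 : (down π ^ n) ((up ^ n) h) = l • h + w := by rw [hw]; abel
  rw [h2, map_add, map_smul, smul_eq_mul, ← wnorm_sq hπ.pos]
  have h3 := (abs_le.1 (abs_weightedInner_le hπ.pos h w)).1
  have h4 := mul_le_mul_of_nonneg_left h1 (wnorm_nonneg π h)
  have h5 : (n : ℝ) * n * (γ * wnorm π h ^ 2) ≤ ((j + n : ℕ) : ℝ) ^ 2 * (γ * wnorm π h ^ 2) := by
    refine mul_le_mul_of_nonneg_right ?_ (mul_nonneg hE.gamma_nonneg (sq_nonneg _))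
    rw [← sq]
    exact pow_le_pow_left₀ n.cast_nonneg (by exact_mod_cast Nat.le_add_left n j) 2
  have h6 := mul_le_mul_of_nonneg_right hR.2 (sq_nonneg (wnorm π h))
  linarith

theorem IsEposet.wnorm_lowerWalk_sub_le (hE : IsEposet d π δ γ) (hX : IsRegular X d)
    (hπ : IsMeasured d π) (hlazy : IsNonLazy π γ) {i j k : ℕ} (hik : i ≤ k) (hjk : j ≤ k)
    (hkd : k ≤ d) {f : X → ℝ} (hf : f ∈ levelSetPiece π k j) :
    wnorm π (lowerWalk π (k - i) f - approxEig δ k i j • f) ≤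
      12 * ((k : ℝ) ^ 2 * (regFun X k j : ℝ)) * γ * wnorm π f := by
  rcases Nat.eq_zero_or_pos k with rfl | hk
  · obtain rfl := Nat.le_zero.1 hik
    simp [lowerWalk, approxEig_self]
  obtain ⟨h, ⟨hh, hker⟩, rfl⟩ := hf
  have hker : down π h = 0 := hker
  have h1 := hE.wnorm_lowerWalk_up_pow_sub_le hX hπ hik hjk hkd hh hker
  have h2 := hE.wnorm_sq_le_wnorm_up_pow_sq hX hπ hlazy hjk hkd hk hh hker
  set f := (up ^ (k - j)) h
  have hR : (1 : ℝ) ≤ regFun X k j := by exact_mod_cast hX.regFun_pos hjk hkd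
  set R : ℝ := (regFun X k j : ℝ)
  have hf0 := wnorm_nonneg π f
  have hh0 := wnorm_nonneg π h
  have hkγ : 0 ≤ (k : ℝ) ^ 2 * γ := mul_nonneg (sq_nonneg _) hE.gamma_nonneg
  rcases le_or_gt (6 * ((k : ℝ) ^ 2 * γ) * R) 1 with hsmall | hlarge
  · -- here `‖h‖² ≤ 2 R ‖f‖²`, and `2 R ≤ (2 R)²`
    have h3 : 6 * ((k : ℝ) ^ 2 * γ) ≤ R⁻¹ := by
      rw [← one_div, le_div_iff₀ (by linarith)]
      exact hsmall
    have h4 : R⁻¹ * wnorm π h ^ 2 ≤ 2 * wnorm π f ^ 2 := by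
      have := mul_le_mul_of_nonneg_right h3 (sq_nonneg (wnorm π h))
      linarith
    have h5 : wnorm π h ^ 2 ≤ 2 * R * wnorm π f ^ 2 := by
      rw [inv_mul_le_iff₀ (by linarith)] at h4
      linarith
    have h6 : wnorm π h ≤ 2 * R * wnorm π f := by
      refine le_of_sq_le_sq ?_ (by positivity)
      have : 2 * R * wnorm π f ^ 2 ≤ (2 * R) ^ 2 * wnorm π f ^ 2 :=
        mul_le_mul_of_nonneg_right (by nlinarith) (sq_nonneg _)
      linarith [mul_pow (2 * R) (wnorm π f) 2]
    have h7 := mul_le_mul_of_nonneg_left h6 hkγ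
    have h8 : 0 ≤ (k : ℝ) ^ 2 * γ * (R * wnorm π f) := mul_nonneg hkγ (by positivity)
    linarith
  · -- here the error term exceeds `2 ‖f‖`, and both the walk and the eigenvalue are at most `1`
    have hl := hE.approxEig_mem_Icc hkd i j
    have h3 : wnorm π (lowerWalk π (k - i) f - approxEig δ k i j • f) ≤ 2 * wnorm π f := by
      rw [sub_eq_add_neg, ← neg_smul]
      refine (wnorm_add_le hπ.pos _ _).trans ?_
      rw [wnorm_smul hπ.pos, abs_neg, abs_of_nonneg hl.1]
      linarith [wnorm_lowerWalk_le hX hπ (k - i) f, mul_le_of_le_one_left hf0 hl.2]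
    have h4 := mul_le_mul_of_nonneg_right hlarge.le hf0
    linarith

/-- For `j ≤ i` the eigenvalue is the quotient of `λ_j(Ň_k^{k-j}) ≈ 1 / R(k,j)` and
`λ_j(Ň_i^{i-j}) ≈ 1 / R(i,j)`. -/
theorem IsEposet.abs_approxEig_sub_regFun_div_le (hE : IsEposet d π δ γ) (hX : IsRegular X d)
    (hπ : IsMeasured d π) (hlazy : IsNonLazy π γ) {i j k : ℕ} (hji : j ≤ i) (hik : i ≤ k)
    (hkd : k ≤ d) (hi : 1 ≤ i) :
    |approxEig δ k i j - (regFun X i j : ℝ) / (regFun X k j : ℝ)| ≤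
      4 * (k : ℝ) ^ 2 * regMax X k * γ := by
  have hi' := abs_le.1 (hE.abs_inv_regFun_sub_approxEig_le hX hπ hlazy hji (hik.trans hkd) hi)
  have hk' := abs_le.1
    (hE.abs_inv_regFun_sub_approxEig_le hX hπ hlazy (hji.trans hik) hkd (hi.trans hik))
  have hmul := approxEig_mul δ hji hik
  have hl := hE.approxEig_mem_Icc hkd i j
  have hRi : (0 : ℝ) < regFun X i j := by exact_mod_cast hX.regFun_pos hji (hik.trans hkd)
  have hRmax : (regFun X i j : ℝ) ≤ regMax X k := by
    exact_mod_cast (hX.regFun_mono hji hik hkd).trans (regFun_le_regMax (hji.trans hik))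
  have hsq : (i : ℝ) ^ 2 * γ ≤ (k : ℝ) ^ 2 * γ :=
    mul_le_mul_of_nonneg_right (pow_le_pow_left₀ i.cast_nonneg (by exact_mod_cast hik) 2)
      hE.gamma_nonneg
  have hkγ : 0 ≤ (k : ℝ) ^ 2 * γ := mul_nonneg (sq_nonneg _) hE.gamma_nonneg
  set l := approxEig δ k i j
  set a := approxEig δ i j j
  set b := approxEig δ k j j
  set r : ℝ := (regFun X i j : ℝ)
  set s : ℝ := (regFun X k j : ℝ)
  have hsplit : l - r / s = r * (l * (r⁻¹ - a) - (s⁻¹ - b)) := by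
    rw [← hmul]
    field_simp
    ring
  rw [hsplit, abs_mul, abs_of_pos hRi]
  have h1 : |l * (r⁻¹ - a) - (s⁻¹ - b)| ≤ 4 * ((k : ℝ) ^ 2 * γ) := by
    have h2 : |l * (r⁻¹ - a)| ≤ 2 * (i : ℝ) ^ 2 * γ := by
      rw [abs_mul, abs_of_nonneg hl.1]
      exact (mul_le_of_le_one_left (abs_nonneg _) hl.2).trans (abs_le.2 hi')
    have h3 := abs_sub (l * (r⁻¹ - a)) (s⁻¹ - b)
    linarith [abs_le.2 hk']
  calc r * |l * (r⁻¹ - a) - (s⁻¹ - b)| ≤ regMax X k * (4 * ((k : ℝ) ^ 2 * γ)) :=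
        mul_le_mul hRmax h1 (abs_nonneg _) (hRi.le.trans hRmax)
    _ = _ := by ring

theorem IsEposet.abs_approxEig_sub_regFun_div_le_of_delta (hE : IsEposet d π δ γ)
    (hX : IsRegular X d) (hπ : IsMeasured d π) (hlazy : IsNonLazy π γ) {i j k : ℕ} (hik : i ≤ k)
    (hkd : k ≤ d) (hjk : j ≤ k) (hδ : i = 0 ∨ 0 < δ i * (1 - δ (i - 1))) :
    |approxEig δ k i j - (regFun X i j : ℝ) / (regFun X k j : ℝ)| ≤
      12 * ((i : ℝ) ^ 4 * (k : ℝ) ^ 2 * (regMax X k : ℝ) / (δ i * (1 - δ (i - 1)))) * γ := by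
  -- a vanishing left-hand side suffices, even for `i = 0`, where the bound is `0`
  have hzero : approxEig δ k i j - (regFun X i j : ℝ) / (regFun X k j : ℝ) = 0 →
      |approxEig δ k i j - (regFun X i j : ℝ) / (regFun X k j : ℝ)| ≤
        12 * ((i : ℝ) ^ 4 * (k : ℝ) ^ 2 * (regMax X k : ℝ) / (δ i * (1 - δ (i - 1)))) * γ := by
    intro h
    rw [h, abs_zero]
    rcases hδ with rfl | hδ
    · simp
    · exact mul_nonneg (by positivity) hE.gamma_nonneg
  have hRk : (regFun X k j : ℝ) ≠ 0 := by exact_mod_cast (hX.regFun_pos hjk hkd).ne'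
  rcases hik.eq_or_lt with rfl | hlt
  · refine hzero ?_
    rw [approxEig_self, div_self hRk, sub_self]
  rcases lt_or_ge i j with hij | hji
  · refine hzero ?_
    rw [approxEig_eq_zero δ hij hjk, regFun_eq_zero hij]
    simp
  rcases Nat.eq_zero_or_pos i with rfl | hi
  · obtain rfl := Nat.le_zero.1 hji
    refine hzero ?_
    have h1 : approxEig δ k 0 0 = 1 := by
      rw [approxEig_eq_prod_Ico]
      refine Finset.prod_eq_one fun m _ => ?_
      rw [Finset.prod_eq_zero (Finset.left_mem_Icc.2 m.zero_le) hE.delta_zero, sub_zero]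
    rw [h1, hX.regFun_zero_right hkd, hX.regFun_zero_right (Nat.zero_le d)]
    simp
  have hδ : 0 < δ i * (1 - δ (i - 1)) := hδ.resolve_left hi.ne'
  have h1 := hE.delta_mem_Icc (hlt.trans_le hkd)
  have h2 := hE.delta_mem_Icc (t := i - 1) (by omega)
  have h3 : δ i * (1 - δ (i - 1)) ≤ 1 := mul_le_one₀ h1.2 (by linarith [h2.2]) (by linarith [h2.1])
  refine (hE.abs_approxEig_sub_regFun_div_le hX hπ hlazy hji hik hkd hi).trans
    (mul_le_mul_of_nonneg_right ?_ hE.gamma_nonneg)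
  have h4 : (1 : ℝ) ≤ (i : ℝ) ^ 4 := one_le_pow₀ (by exact_mod_cast hi)
  have h5 : (k : ℝ) ^ 2 * regMax X k ≤ (i : ℝ) ^ 4 * (k : ℝ) ^ 2 * regMax X k := by
    rw [mul_assoc]
    exact le_mul_of_one_le_left (by positivity) h4
  have h6 := h5.trans (le_div_self (by positivity) hδ h3)
  have h7 : (0 : ℝ) ≤ (k : ℝ) ^ 2 * regMax X k := by positivity
  linarith

end LowerWalk

end ExpandingPoset

theorem mainTheorem3 :
    ∃ C : ℝ, 0 < C ∧
      ∀ (X : Type u) [PartialOrder X] [OrderBot X] [GradeMinOrder ℕ X] [Fintype X]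
        (d : ℕ) (π : X → ℝ) (δ : ℕ → ℝ) (γ : ℝ),
        ExpandingPoset.IsRegular X d →
        ExpandingPoset.IsMeasured d π →
        ExpandingPoset.IsEposet d π δ γ →
        ExpandingPoset.IsNonLazy π γ →
        ∀ i k j : ℕ, i ≤ k → k ≤ d → j ≤ k →
          (∀ f ∈ ExpandingPoset.levelSetPiece π k j,
            ExpandingPoset.wnorm π
                (ExpandingPoset.lowerWalk π (k - i) f - ExpandingPoset.approxEig δ k i j • f) ≤
              C * ((k : ℝ) ^ 2 * (ExpandingPoset.regFun X k j : ℝ)) * γ *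
                ExpandingPoset.wnorm π f) ∧
          ((i = 0 ∨ 0 < δ i * (1 - δ (i - 1))) →
            |ExpandingPoset.approxEig δ k i j -
                (ExpandingPoset.regFun X i j : ℝ) / (ExpandingPoset.regFun X k j : ℝ)| ≤
              C * ((i : ℝ) ^ 4 * (k : ℝ) ^ 2 * (ExpandingPoset.regMax X k : ℝ) /
                (δ i * (1 - δ (i - 1)))) * γ) := by
  refine ⟨12, by norm_num, ?_⟩
  intro X _ _ _ _ d π δ γ hX hπ hE hlazy i k j hik hkd hjk
  exact ⟨fun f hf => hE.wnorm_lowerWalk_sub_le hX hπ hlazy hik hjk hkd hf,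
    hE.abs_approxEig_sub_regFun_div_le_of_delta hX hπ hlazy hik hkd hjk⟩
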